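/- Let $p$ be a prime and let $k$ be an algebraically closed field of characteristic $p$. Let $X$ be a finite group of order divisible by $p$ such that $O_{p'}(X) = 1$ (that is, $X$ has no non-trivial normal subgroup of order prime to $p$), and suppose that $X$ has a strongly $p$-embedded subgroup $Y$, that is, a proper subgroup $Y$ of order divisible by $p$ such that $Y \cap g^{-1}Yg$ has order prime to $p$ for every $g \in X \setminus Y$. Then there is a finite group $G$ whose generalized Fitting subgroup $A = F^{*}(G)$ is an Abelian group of order prime to $p$, with $G/A \cong X$, and there is a simple endotrivial $kG$-module which is induced from a $1$-dimensional $kH$-module for some proper subgroup $H$ of $G$. Here $F^{*}(G) = F(G)E(G)$, where $F(G)$ is the largest nilpotent normal subgroup of $G$ and $E(G)$ is the subgroup generated by the components (the quasi-simple subnormal subgroups) of $G$; and a finite-dimensional $kG$-module $M$ is endotrivial if $M \otimes_k M^{*} \cong k \oplus S$ with $k$ the trivial module and $S$ a projective $kG$-module. -/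

import Mathlib

open scoped Pointwise MonoidAlgebra

universe u v

/-- The proper subgroup `H` of `G` is strongly `p`-embedded: `p` divides `|H|`, but
`H ∩ H ^ g` is a `p'`-group for every `g` outside `H` (where `H ^ g = g⁻¹ H g`). -/
def IsStronglyEmbedded {G : Type*} [Group G] (p : ℕ) (H : Subgroup G) : Prop :=
  H ≠ ⊤ ∧ p ∣ Nat.card H ∧
    ∀ g : G, g ∉ H → ¬ p ∣ Nat.card (H ⊓ MulAut.conj g⁻¹ • H : Subgroup G)

/-- `O_{p'}(G)`, the subgroup generated by all normal `p'`-subgroups; for finite `G` and prime `p`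
it is the largest normal `p'`-subgroup. -/
def pPrimeCore (p : ℕ) (G : Type*) [Group G] : Subgroup G :=
  sSup {N : Subgroup G | N.Normal ∧ ¬ p ∣ Nat.card N}

/-- `F(G)`, the subgroup generated by all nilpotent normal subgroups; for finite `G` it is the
largest nilpotent normal subgroup. -/
def fittingSubgroup (G : Type*) [Group G] : Subgroup G :=
  sSup {N : Subgroup G | N.Normal ∧ Group.IsNilpotent N}

/-- A group is quasi-simple if it is perfect and simple modulo its centre. -/
def IsQuasiSimpleGroup (L : Type*) [Group L] : Prop :=
  Group.IsPerfect L ∧ IsSimpleGroup (L ⧸ Subgroup.center L)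

/-- `E(G)`, the subgroup generated by the components (quasi-simple subnormal subgroups). -/
def layer (G : Type*) [Group G] : Subgroup G :=
  sSup {L : Subgroup G | L.IsSubnormal ∧ IsQuasiSimpleGroup L}

/-- The generalized Fitting subgroup `F*(G) = F(G) E(G)`. -/
def generalizedFittingSubgroup (G : Type*) [Group G] : Subgroup G :=
  fittingSubgroup G ⊔ layer G

/-- A finite-dimensional `kG`-module `M` is endotrivial if `M ⊗ M*` is the (internal) direct sum
of a submodule isomorphic to the trivial module `k` and a projective submodule. -/
def IsEndotrivial {k G M : Type*} [Field k] [Group G] [AddCommGroup M] [Module k M]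
    (ρ : Representation k G M) : Prop :=
  FiniteDimensional k M ∧
    ∃ T P : Submodule k[G] (ρ.tprod ρ.dual).asModule,
      IsCompl T P ∧
      Nonempty (T ≃ₗ[k[G]] (Representation.trivial k G k).asModule) ∧
      Module.Projective k[G] P

/-
Let `G = C ≀ X` be the wreath product over the cosets `Ω = X ⧸ Y`, where `C` is a nontrivial
`p'`-group with a linear character `χ ≠ 1`, acting on `V = k ^ Ω` by monomial matrices. The base
group is an abelian `p'`-group and contains its centralizer, as `X` acts faithfully on `Ω`; hence it
is `F*(G)`. The module `V` is induced from the stabilizer of a coset, and irreducible because the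
copy of `C` at a coset contains reflections.

That `Y` is strongly embedded means that elements of order `p` fix at most one point of `Ω`. Thus
`dim V = |Ω| ≡ 1 mod p`, so `End V` is the sum of the scalars and the trace-zero endomorphisms, and
stabilizers of pairs of distinct points are `p'`-groups. With `P_x` the coordinate projections,
`f - tr f = ∑_{x ≠ y} (P_x f P_y - tr (f P_y) P_x)`, and `G` permutes the terms. A weighting of the
pairs `x ≠ y` whose sum along each orbit map is `1` turns this into an expression of the projection
onto the trace-zero part as a sum of conjugates, and Higman's criterion shows that part to be
projective.
-/

section GeneralizedFitting

variable {G : Type*} [Group G]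

theorem commutator_eq_bot_of_commutator_commutator_eq_bot {B L : Subgroup G} [Group.IsPerfect L]
    (h : ⁅⁅B, L⁆, L⁆ = ⊥) : ⁅B, L⁆ = ⊥ := by
  have hrot := Subgroup.commutator_commutator_eq_bot_of_rotate (H₁ := L) (H₂ := L) (H₃ := B)
    (by rwa [Subgroup.commutator_comm L B]) h
  rwa [Subgroup.isPerfect_iff.mp ‹_›, Subgroup.commutator_comm] at hrot

/- Climbing a subnormal series `H ⊴ K ⊴ ⋯ ⊴ G`, the commutator `⁅A ⊓ K, L⁆` lands in `A ⊓ H`. -/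
theorem commutator_eq_bot_of_isSubnormal {A H L : Subgroup G} [A.Normal] [Group.IsPerfect L]
    (hH : H.IsSubnormal) (hLH : L ≤ H) (h : ⁅A ⊓ H, L⁆ = ⊥) : ⁅A, L⁆ = ⊥ := by
  induction hH with
  | top => rwa [inf_top_eq] at h
  | step H K hHK _ hN ih =>
    have hKL : ⁅A ⊓ K, L⁆ ≤ A ⊓ H := by
      rw [Subgroup.normal_subgroupOf_iff_le_normalizer hHK,
        Subgroup.le_normalizer_iff_commutator_le_left, Subgroup.commutator_comm] at hN
      exact le_inf ((Subgroup.commutator_mono inf_le_left le_rfl).trans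
        (Subgroup.commutator_le_left A L)) ((Subgroup.commutator_mono inf_le_right hLH).trans hN)
    exact ih (hLH.trans hHK) (commutator_eq_bot_of_commutator_commutator_eq_bot
      (le_bot_iff.mp ((Subgroup.commutator_mono hKL le_rfl).trans h.le)))

theorem IsQuasiSimpleGroup.le_center_of_isMulCommutative {L : Type*} [Group L]
    (hL : IsQuasiSimpleGroup L) (B : Subgroup L) [B.Normal] [IsMulCommutative B] :
    B ≤ Subgroup.center L := by
  obtain ⟨hperf, hsimple⟩ := hL
  let π := QuotientGroup.mk' (Subgroup.center L)
  have hπ : Function.Surjective π := QuotientGroup.mk'_surjective _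
  rcases (Subgroup.Normal.map inferInstance π hπ : (B.map π).Normal).eq_bot_or_eq_top with h | h
  · rwa [Subgroup.map_eq_bot_iff, QuotientGroup.ker_mk'] at h
  · have hcomm : IsMulCommutative (L ⧸ Subgroup.center L) := by
      refine ⟨⟨fun x y ↦ ?_⟩⟩
      obtain ⟨a, ha, rfl⟩ : x ∈ B.map π := h ▸ Subgroup.mem_top x
      obtain ⟨b, hb, rfl⟩ : y ∈ B.map π := h ▸ Subgroup.mem_top y
      rw [← map_mul, ← map_mul, setLike_mul_comm ha hb]
    exact absurd (Group.IsPerfect.subsingleton_of_isMulCommutative (G := L ⧸ Subgroup.center L))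
      (not_subsingleton_iff_nontrivial.mpr inferInstance)

theorem IsQuasiSimpleGroup.commutator_eq_bot {L : Subgroup G} (hL : IsQuasiSimpleGroup L)
    (hs : L.IsSubnormal) (A : Subgroup G) [A.Normal] [IsMulCommutative A] : ⁅A, L⁆ = ⊥ := by
  have := hL.1
  refine commutator_eq_bot_of_isSubnormal hs le_rfl ?_
  have : IsMulCommutative (A.subgroupOf L) :=
    ⟨⟨fun a b ↦ Subtype.ext (Subtype.ext (setLike_mul_comm (s := A) a.2 b.2))⟩⟩
  have hcenter : A.subgroupOf L ≤ Subgroup.center L := hL.le_center_of_isMulCommutative _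
  rw [Subgroup.commutator_eq_bot_iff_le_centralizer]
  rintro a ⟨haA, haL⟩
  refine Subgroup.mem_centralizer_iff.mpr fun l hl ↦ ?_
  exact congrArg Subtype.val (Subgroup.mem_center_iff.mp (hcenter (x := ⟨a, haL⟩) haA) ⟨l, hl⟩)

theorem layer_le_centralizer (A : Subgroup G) [A.Normal] [IsMulCommutative A] :
    layer G ≤ Subgroup.centralizer A := by
  refine sSup_le fun L ⟨hs, hL⟩ ↦ ?_
  rw [← Subgroup.commutator_eq_bot_iff_le_centralizer, Subgroup.commutator_comm]
  exact hL.commutator_eq_bot hs A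

theorem not_dvd_card_of_isNilpotent {p : ℕ} [Fact p.Prime] {A N : Subgroup G} [A.Normal]
    [N.Normal] [Finite N] [Group.IsNilpotent N] (hA : ¬ p ∣ Nat.card A)
    (hc : Subgroup.centralizer (A : Set G) ≤ A) : ¬ p ∣ Nat.card N := by
  let S : Sylow p N := default
  have hS : S.Normal :=
    (Group.isNilpotent_of_finite_tfae.out 0 3 rfl rfl).mp ‹Group.IsNilpotent N› p ‹_› S
  have := S.characteristic_of_normal hS
  let P : Subgroup G := (S : Subgroup N).map N.subtype
  have hdisj : Disjoint P A := by
    have : Finite P := .of_injective _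
      (Subgroup.inclusion_injective (Subgroup.map_subtype_le (S : Subgroup N)))
    have hP : IsPGroup p P := S.2.map N.subtype
    obtain ⟨n, hn⟩ := IsPGroup.iff_card.mp hP
    refine Subgroup.disjoint_of_coprime_natCard ?_
    rw [hn]
    exact Nat.Coprime.pow_left n ((Nat.Prime.coprime_iff_not_dvd Fact.out).mpr hA)
  have hPA : P ≤ A := (Subgroup.commutator_eq_bot_iff_le_centralizer.mp
    (Subgroup.commutator_eq_bot_of_disjoint hdisj)).trans hc
  have hSbot : (S : Subgroup N) = ⊥ :=
    (Subgroup.map_eq_bot_iff_of_injective _ N.subtype_injective).mp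
      (le_bot_iff.mp (hdisj le_rfl hPA))
  exact fun h ↦ S.ne_bot_of_dvd_card h hSbot

theorem le_ker_of_pPrimeCore_eq_bot {X : Type*} [Group X] {p : ℕ} (hX : pPrimeCore p X = ⊥)
    {π : G →* X} (hπ : Function.Surjective π) {N : Subgroup G} [hN : N.Normal]
    (hp : ¬ p ∣ Nat.card N) : N ≤ π.ker := by
  rw [← Subgroup.map_eq_bot_iff, ← le_bot_iff, ← hX]
  exact le_sSup ⟨hN.map π hπ, fun h ↦ hp (h.trans (N.card_map_dvd π))⟩

theorem generalizedFittingSubgroup_eq_ker [Finite G] {X : Type*} [Group X] {p : ℕ} [Fact p.Prime]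
    (hX : pPrimeCore p X = ⊥) {π : G →* X} (hπ : Function.Surjective π) [IsMulCommutative π.ker]
    (hp : ¬ p ∣ Nat.card π.ker) (hc : Subgroup.centralizer (π.ker : Set G) ≤ π.ker) :
    generalizedFittingSubgroup G = π.ker := by
  refine le_antisymm (sup_le (sSup_le ?_) ((layer_le_centralizer π.ker).trans hc))
    (le_sup_of_le_left (le_sSup ⟨inferInstance, ?_⟩))
  · rintro N ⟨_, _⟩
    exact le_ker_of_pPrimeCore_eq_bot hX hπ (not_dvd_card_of_isNilpotent hp hc)
  · let _ : CommGroup π.ker := { mul_comm := fun a b ↦ mul_comm' a b }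
    exact CommGroup.isNilpotent

end GeneralizedFitting

section FixedPoints

variable {p : ℕ} {G Ω : Type*} [Group G] [MulAction G Ω]

/-- Every element of order `p` fixes at most one point. The action of a group on the cosets of a
strongly `p`-embedded subgroup has this property, and it is the only consequence of strong
embedding that the construction of the endotrivial module depends on. -/
def AtMostOneFixedPoint (p : ℕ) (G Ω : Type*) [Group G] [MulAction G Ω] : Prop :=
  ∀ g : G, orderOf g = p → (MulAction.fixedBy Ω g).Subsingleton

theorem IsStronglyEmbedded.atMostOneFixedPoint {H : Subgroup G} (hH : IsStronglyEmbedded p H) :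
    AtMostOneFixedPoint p G (G ⧸ H) := by
  intro g hg x hx y hy
  obtain ⟨a, rfl⟩ := QuotientGroup.mk_surjective x
  obtain ⟨b, rfl⟩ := QuotientGroup.mk_surjective y
  have conj_mem {c : G} (hc : g • (c : G ⧸ H) = c) : c⁻¹ * g * c ∈ H := by
    rw [mul_assoc]
    exact QuotientGroup.eq.mp hc.symm
  rw [QuotientGroup.eq]
  by_contra hab
  refine hH.2.2 (b⁻¹ * a) (fun h ↦ hab (by simpa using H.inv_mem h)) ?_
  have hmem : a⁻¹ * g * a ∈ H ⊓ MulAut.conj (b⁻¹ * a)⁻¹ • H := by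
    refine ⟨conj_mem hx, Subgroup.mem_pointwise_smul_iff_inv_smul_mem.mpr ?_⟩
    simpa [← map_inv, MulAut.smul_def, mul_assoc] using conj_mem hy
  have horder : orderOf (a⁻¹ * g * a) = p := by
    rw [← hg, ← MulAut.conj_inv_apply]
    exact MulEquiv.orderOf_eq _ g
  rw [← horder, ← Subgroup.orderOf_mk _ hmem]
  exact orderOf_dvd_natCard _

namespace AtMostOneFixedPoint

theorem not_dvd_card_stabilizer [Finite G] [Fact p.Prime] (hΩ : AtMostOneFixedPoint p G Ω)
    {x y : Ω} (hxy : x ≠ y) : ¬ p ∣ Nat.card (MulAction.stabilizer G (x, y)) := fun hp ↦ by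
  obtain ⟨⟨g, hg⟩, hgp⟩ := exists_prime_orderOf_dvd_card' p hp
  rw [Subgroup.orderOf_mk] at hgp
  obtain ⟨hx, hy⟩ := Prod.mk.inj hg
  exact hxy (hΩ g hgp hx hy)

theorem card_modEq_one [Finite Ω] [Fact p.Prime] (hΩ : AtMostOneFixedPoint p G Ω) {g : G}
    (hg : orderOf g = p) {ω : Ω} (hω : g • ω = ω) : Nat.card Ω ≡ 1 [MOD p] := by
  let P := Subgroup.zpowers g
  have hP : IsPGroup p P := IsPGroup.of_card (n := 1) (by rw [Nat.card_zpowers, hg, pow_one])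
  have hfix : MulAction.fixedPoints P Ω = {ω} := by
    refine Set.Subsingleton.eq_singleton_of_mem (fun x hx y hy ↦ ?_) ?_
    · exact hΩ g hg (hx ⟨g, Subgroup.mem_zpowers g⟩) (hy ⟨g, Subgroup.mem_zpowers g⟩)
    · exact fun h ↦ Subgroup.zpowers_le.mpr (show g ∈ MulAction.stabilizer G ω from hω) h.2
  simpa only [hfix, Nat.card_unique] using hP.card_modEq_card_fixedPoints Ω

theorem not_dvd_card_ker_toPermHom [Finite G] [Fact p.Prime] [Nontrivial Ω]
    (hΩ : AtMostOneFixedPoint p G Ω) : ¬ p ∣ Nat.card (MulAction.toPermHom G Ω).ker := fun hp ↦ by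
  obtain ⟨g, hg⟩ := exists_prime_orderOf_dvd_card' p hp
  have hfix : ∀ x : Ω, (g : G) • x = x := Equiv.ext_iff.mp g.2
  obtain ⟨x, y, hxy⟩ := exists_pair_ne Ω
  exact hxy (hΩ g ((Subgroup.orderOf_coe g).trans hg) (hfix x) (hfix y))

theorem faithfulSMul [Finite G] [Fact p.Prime] [Nontrivial Ω] (hΩ : AtMostOneFixedPoint p G Ω)
    (hG : pPrimeCore p G = ⊥) : FaithfulSMul G Ω := by
  have hker : (MulAction.toPermHom G Ω).ker ≤ pPrimeCore p G :=
    le_sSup ⟨inferInstance, hΩ.not_dvd_card_ker_toPermHom⟩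
  rw [hG, le_bot_iff, MonoidHom.ker_eq_bot_iff] at hker
  exact ⟨fun h ↦ hker (Equiv.ext h)⟩

/- An element of order `p` of the larger group keeps its order, as it cannot lie in the kernel. -/
theorem compHom {E : Type*} [Group E] [Fact p.Prime] (hΩ : AtMostOneFixedPoint p G Ω)
    (π : E →* G) (hπ : ¬ p ∣ Nat.card π.ker) :
    letI := MulAction.compHom Ω π; AtMostOneFixedPoint p E Ω := by
  intro g hg
  refine hΩ (π g) (((Nat.dvd_prime Fact.out).mp (hg ▸ orderOf_map_dvd π g)).resolve_left ?_)
  rintro h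
  have hmem : g ∈ π.ker := orderOf_eq_one_iff.mp h
  exact hπ (hg ▸ Subgroup.orderOf_mk g hmem ▸ orderOf_dvd_natCard _)

end AtMostOneFixedPoint

theorem IsStronglyEmbedded.card_quotient_modEq_one [Finite G] [Fact p.Prime] {H : Subgroup G}
    (hH : IsStronglyEmbedded p H) : Nat.card (G ⧸ H) ≡ 1 [MOD p] := by
  obtain ⟨g, hg⟩ := exists_prime_orderOf_dvd_card' p hH.2.1
  refine hH.atMostOneFixedPoint.card_modEq_one ((Subgroup.orderOf_coe g).trans hg)
    (ω := ((1 : G) : G ⧸ H)) ?_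
  exact (QuotientGroup.eq.mpr (by simp)).symm

end FixedPoints

section Projectivity

theorem exists_weight_sum_smul_eq_one (k G : Type*) {Ω : Type*} [Field k] [Group G] [Fintype G]
    [MulAction G Ω] : ∃ w : Ω → k, ∀ z : Ω,
      (Nat.card (MulAction.stabilizer G z) : k) ≠ 0 → ∑ g : G, w (g • z) = 1 := by
  classical
  let r : Ω → Ω := fun z ↦ (Quotient.mk (MulAction.orbitRel G Ω) z).out
  have r_smul (g : G) (z : Ω) : r (g • z) = r z :=
    congrArg Quotient.out (Quotient.sound (s := MulAction.orbitRel G Ω) ⟨g, rfl⟩)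
  let w : Ω → k := fun z ↦ if z = r z then (Nat.card (MulAction.stabilizer G z) : k)⁻¹ else 0
  have sum_w_rep (z : Ω) (hz : (Nat.card (MulAction.stabilizer G (r z)) : k) ≠ 0) :
      ∑ g : G, w (g • r z) = 1 := by
    have hw (g : G) : w (g • r z) =
        if g • r z = r z then (Nat.card (MulAction.stabilizer G (r z)) : k)⁻¹ else 0 := by
      have hr : r (g • r z) = r z := by rw [r_smul, show r (r z) = r z by simp [r]]
      simp only [w, hr]
      split_ifs with h
      · rw [h]
      · rfl
    have hcard : (Finset.univ.filter fun g : G ↦ g • r z = r z).card =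
        Nat.card (MulAction.stabilizer G (r z)) := by
      rw [← Fintype.card_subtype, ← Nat.card_eq_fintype_card]
      rfl
    rw [Finset.sum_congr rfl fun g _ ↦ hw g, Finset.sum_ite, Finset.sum_const_zero, add_zero,
      Finset.sum_const, nsmul_eq_mul, hcard, mul_inv_cancel₀ hz]
  refine ⟨w, fun z hz ↦ ?_⟩
  obtain ⟨h, hh⟩ : ∃ h : G, h • z = r z :=
    MulAction.mem_orbit_iff.mp (Quotient.mk_out (s := MulAction.orbitRel G Ω) z)
  calc
    ∑ g : G, w (g • z) = ∑ g : G, w ((g * h) • z) :=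
      (Equiv.sum_comp (Equiv.mulRight h) fun g : G ↦ w (g • z)).symm
    _ = ∑ g : G, w (g • r z) := by simp only [mul_smul, hh]
    _ = 1 := sum_w_rep z
      (by rwa [← Nat.card_congr (MulAction.stabilizerEquivStabilizer hh.symm).toEquiv])

variable {k G M : Type*} [CommRing k] [Group G] [Fintype G]
  [AddCommGroup M] [Module k M] [Module k[G] M] [IsScalarTower k k[G] M]

theorem projective_of_sumOfConjugates_eq [Module.Projective k M] (φ : M →ₗ[k] M)
    (hφ : ∀ m, φ.sumOfConjugates G m = m) : Module.Projective k[G] M := by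
  obtain ⟨s, hs⟩ := Module.projective_def'.mp ‹Module.Projective k M›
  let s' : M →ₗ[k] (M →₀ k[G]) := Finsupp.mapRange.linearMap (Algebra.linearMap k k[G]) ∘ₗ s
  let π : (M →₀ k[G]) →ₗ[k[G]] M := Finsupp.linearCombination k[G] id
  have hπ : π.restrictScalars k ∘ₗ Finsupp.mapRange.linearMap (Algebra.linearMap k k[G]) =
      Finsupp.linearCombination k id :=
    Finsupp.lhom_ext' fun m ↦ LinearMap.ext_ring (by simp [π, ← MonoidAlgebra.one_def])
  have hπs (m : M) : π (s' m) = m :=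
    (LinearMap.congr_fun hπ (s m)).trans (LinearMap.congr_fun hs m)
  refine Module.Projective.of_split ((s' ∘ₗ φ).sumOfConjugatesEquivariant G) π ?_
  ext m
  rw [LinearMap.comp_apply, LinearMap.sumOfConjugatesEquivariant_apply, map_sum, LinearMap.id_apply]
  conv_rhs => rw [← hφ m, LinearMap.sumOfConjugates_apply]
  refine Finset.sum_congr rfl fun g _ ↦ ?_
  rw [LinearMap.conjugate_apply, LinearMap.conjugate_apply, map_smul, LinearMap.comp_apply, hπs]

theorem projective_of_isCompl_of_sumOfConjugates_eq {P Q : Submodule k[G] M}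
    [Module.Projective k M] (hPQ : IsCompl P Q) (φ : M →ₗ[k] M)
    (hφ : ∀ m ∈ P, φ.sumOfConjugates G m = m) : Module.Projective k[G] P := by
  let π := P.projectionOnto Q hPQ
  have : Module.Projective k P := .of_split (P.subtype.restrictScalars k) (π.restrictScalars k) <|
    LinearMap.ext fun m ↦ Submodule.projectionOnto_apply_left hPQ m
  refine projective_of_sumOfConjugates_eq
    (π.restrictScalars k ∘ₗ φ ∘ₗ P.subtype.restrictScalars k) fun m ↦ ?_
  calc
    _ = π (φ.sumOfConjugates G m) := by
      simp only [LinearMap.sumOfConjugates_apply, LinearMap.conjugate_apply, map_sum, map_smul,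
        LinearMap.comp_apply, LinearMap.coe_restrictScalars, Submodule.coe_subtype]
    _ = m := by rw [hφ m m.2, Submodule.projectionOnto_apply_left]

theorem isCompl_range_ker_of_bijective_comp {R M N P : Type*} [Ring R] [AddCommGroup M]
    [AddCommGroup N] [AddCommGroup P] [Module R M] [Module R N] [Module R P] {i : N →ₗ[R] M}
    {t : M →ₗ[R] P} (h : Function.Bijective (t ∘ₗ i)) :
    IsCompl (LinearMap.range i) (LinearMap.ker t) := by
  constructor
  · rw [Submodule.disjoint_def]
    rintro _ ⟨n, rfl⟩ hn
    rw [(map_eq_zero_iff (t ∘ₗ i) h.1).mp hn, map_zero]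
  · rw [codisjoint_iff, Submodule.eq_top_iff']
    intro m
    obtain ⟨n, hn⟩ := h.2 (t m)
    exact Submodule.mem_sup.mpr
      ⟨i n, ⟨n, rfl⟩, m - i n, by simpa [sub_eq_zero] using hn.symm, by simp⟩

end Projectivity

theorem trace_conj {k G V : Type*} [CommRing k] [Group G] [AddCommGroup V] [Module k V]
    (ρ : Representation k G V) (g : G) (f : Module.End k V) :
    LinearMap.trace k V (ρ g * f * ρ g⁻¹) = LinearMap.trace k V f := by
  rw [LinearMap.trace_mul_comm, ← mul_assoc, ← map_mul, inv_mul_cancel, map_one, one_mul]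

namespace IsEndotrivial

variable {k G V : Type*} [Field k] [Group G] [AddCommGroup V] [Module k V] [FiniteDimensional k V]
  {ρ : Representation k G V}

theorem of_linHom {T P : Submodule k[G] (ρ.linHom ρ).asModule} (hTP : IsCompl T P)
    (hT : Nonempty (T ≃ₗ[k[G]] (Representation.trivial k G k).asModule))
    (hP : Module.Projective k[G] P) : IsEndotrivial ρ := by
  let ε : (ρ.tprod ρ.dual).Equiv (ρ.linHom ρ) :=
    (Representation.TensorProduct.comm ρ ρ.dual).trans (Representation.Equiv.dualTensorHom ρ ρ)
  let e : (ρ.tprod ρ.dual).asModule ≃ₗ[k[G]] (ρ.linHom ρ).asModule :=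
    .ofBijective (Representation.IntertwiningMap.equivLinearMapAsModule _ _ ε.toIntertwiningMap)
      ε.toLinearEquiv.bijective
  exact ⟨inferInstance, T.comap e.toLinearMap, P.comap e.toLinearMap,
    (Submodule.orderIsoMapComap e).symm.isCompl hTP, hT.map (e.ofSubmodule' T).trans,
    Module.Projective.of_equiv (e.ofSubmodule' P).symm⟩

theorem of_sum_conj_eq [Fintype G] (hV : (Module.finrank k V : k) ≠ 0)
    (ψ : Module.End k V →ₗ[k] Module.End k V)
    (hψ : ∀ f, LinearMap.trace k V f = 0 → ∑ g, ρ g⁻¹ * ψ (ρ g * f * ρ g⁻¹) * ρ g = f) :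
    IsEndotrivial ρ := by
  let scalar : (Representation.trivial k G k).IntertwiningMap (ρ.linHom ρ) :=
    { toLinearMap := Algebra.linearMap k (Module.End k V)
      isIntertwining' := fun g ↦ by ext; simp }
  let trace : (ρ.linHom ρ).IntertwiningMap (Representation.trivial k G k) :=
    { toLinearMap := LinearMap.trace k V
      isIntertwining' := fun g ↦ by
        ext f
        exact trace_conj ρ g f }
  let i := Representation.IntertwiningMap.equivLinearMapAsModule _ _ scalar
  let t := Representation.IntertwiningMap.equivLinearMapAsModule _ _ trace
  have hti : ⇑(t ∘ₗ i) = fun c : k ↦ c * (Module.finrank k V : k) := funext fun c ↦ by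
    refine ((LinearMap.trace k V).map_smul (c : k) 1).trans ?_
    rw [LinearMap.trace_one]
    rfl
  have hbij : Function.Bijective (t ∘ₗ i) := hti ▸ mulRight_bijective₀ _ hV
  have hcompl := isCompl_range_ker_of_bijective_comp hbij
  have hinj : Function.Injective i := .of_comp (f := t) hbij.1
  have : Module.Projective k (ρ.linHom ρ).asModule :=
    inferInstanceAs (Module.Projective k (Module.End k V))
  let φ : (ρ.linHom ρ).asModule →ₗ[k] (ρ.linHom ρ).asModule := ψ
  have conj_eq (f : Module.End k V) (g : G) : (ρ.linHom ρ) g⁻¹ (ψ ((ρ.linHom ρ) g f)) =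
      ρ g⁻¹ * ψ (ρ g * f * ρ g⁻¹) * ρ g := by
    change ρ g⁻¹ * (ψ (ρ g * (f * ρ g⁻¹)) * ρ g⁻¹⁻¹) = _
    simp only [inv_inv, mul_assoc]
  refine of_linHom hcompl ⟨(LinearEquiv.ofInjective i hinj).symm⟩
    (projective_of_isCompl_of_sumOfConjugates_eq hcompl.symm φ fun f hf ↦ .trans ?_ (hψ f hf))
  rw [LinearMap.sumOfConjugates_apply]
  refine Finset.sum_congr rfl fun g _ ↦ ?_
  rw [LinearMap.conjugate_apply, Representation.single_smul, Representation.single_smul, one_smul,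
    one_smul]
  exact conj_eq f g

end IsEndotrivial

section Monomial

variable {k G V Ω : Type*} [Field k] [Group G] [MulAction G Ω] [AddCommGroup V] [Module k V]
  {ρ : Representation k G V} {b : Module.Basis Ω k V}

/-- The representation `ρ` is monomial with respect to the basis `b`: along the action of `G` on
the index set of `b`, it permutes the basis vectors up to nonzero scalars. -/
def IsMonomial (ρ : Representation k G V) (b : Module.Basis Ω k V) : Prop :=
  ∀ g ω, ∃ c : kˣ, ρ g (b ω) = c • b (g • ω)

/-- The projection of `V` onto the line spanned by the basis vector `b x`, along the other basis
vectors, as an element of the algebra `Module.End k V`. -/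
noncomputable def coordProj (b : Module.Basis Ω k V) (x : Ω) : Module.End k V :=
  (b.coord x).smulRight (b x)

theorem coordProj_apply (x : Ω) (v : V) : coordProj b x v = b.repr v x • b x := rfl

theorem coordProj_self (x : Ω) : coordProj b x (b x) = b x := by
  rw [coordProj_apply, b.repr_self, Finsupp.single_eq_same, one_smul]

theorem coordProj_of_ne {x y : Ω} (h : y ≠ x) : coordProj b x (b y) = 0 := by
  rw [coordProj_apply, b.repr_self, Finsupp.single_eq_of_ne h.symm, zero_smul]

theorem sum_coordProj [Fintype Ω] (b : Module.Basis Ω k V) : ∑ x, coordProj b x = 1 :=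
  LinearMap.ext fun v ↦ by
    simp only [LinearMap.sum_apply, coordProj_apply, b.sum_repr, Module.End.one_apply]

theorem coordProj_mul_mul_coordProj [FiniteDimensional k V] (f : Module.End k V) (x : Ω) :
    coordProj b x * f * coordProj b x =
      LinearMap.trace k V (f * coordProj b x) • coordProj b x := by
  have htrace : LinearMap.trace k V (f * coordProj b x) = b.repr (f (b x)) x := by
    have hmul : f * coordProj b x = (b.coord x).smulRight (f (b x)) :=
      LinearMap.ext fun v ↦ map_smul f _ _
    rw [hmul, LinearMap.trace_smulRight, b.coord_apply]
  ext v
  rw [htrace, LinearMap.smul_apply, Module.End.mul_apply, Module.End.mul_apply, coordProj_apply x v,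
    map_smul, map_smul, coordProj_apply, smul_comm]

/-- The map sending `f` to its `z`-entry, minus the multiple of the projection onto the first
basis vector that makes the sum over all `z` equal to `f - tr f`. -/
noncomputable def reducedEntry (b : Module.Basis Ω k V) (z : Ω × Ω) :
    Module.End k V →ₗ[k] Module.End k V :=
  LinearMap.mulLeft k (coordProj b z.1) ∘ₗ LinearMap.mulRight k (coordProj b z.2) -
    (LinearMap.trace k V ∘ₗ LinearMap.mulRight k (coordProj b z.2)).smulRight (coordProj b z.1)

theorem reducedEntry_apply (z : Ω × Ω) (f : Module.End k V) :
    reducedEntry b z f = coordProj b z.1 * (f * coordProj b z.2) -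
      LinearMap.trace k V (f * coordProj b z.2) • coordProj b z.1 := rfl

theorem reducedEntry_diag [FiniteDimensional k V] (x : Ω) : reducedEntry b (x, x) = 0 := by
  ext1 f
  rw [reducedEntry_apply, ← mul_assoc, coordProj_mul_mul_coordProj, sub_self, LinearMap.zero_apply]

theorem sum_reducedEntry [Fintype Ω] (b : Module.Basis Ω k V) (f : Module.End k V) :
    ∑ z, reducedEntry b z f = f - LinearMap.trace k V f • 1 := by
  simp only [reducedEntry_apply, Fintype.sum_prod_type, Finset.sum_sub_distrib, ← Finset.mul_sum,
    ← Finset.sum_mul, ← Finset.sum_smul, ← Finset.smul_sum, ← map_sum, sum_coordProj, mul_one,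
    one_mul]

namespace IsMonomial

theorem mul_coordProj (hρ : IsMonomial ρ b) (g : G) (x : Ω) :
    ρ g * coordProj b x = coordProj b (g • x) * ρ g := by
  refine b.ext fun y ↦ ?_
  obtain ⟨c, hc⟩ := hρ g y
  rw [Module.End.mul_apply, Module.End.mul_apply, hc, Units.smul_def, map_smul]
  obtain rfl | hy := eq_or_ne y x
  · rw [coordProj_self, coordProj_self, hc, Units.smul_def]
  · rw [coordProj_of_ne hy, coordProj_of_ne ((MulAction.injective g).ne hy), map_zero, smul_zero]

theorem conj_reducedEntry (hρ : IsMonomial ρ b) (g : G) (z : Ω × Ω) (f : Module.End k V) :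
    ρ g⁻¹ * reducedEntry b (g • z) (ρ g * f * ρ g⁻¹) * ρ g = reducedEntry b z f := by
  have hcancel (a : Module.End k V) : ρ g⁻¹ * (ρ g * a) = a := by
    rw [← mul_assoc, ← map_mul, inv_mul_cancel, map_one, one_mul]
  have hproj (x : Ω) : coordProj b (g • x) = ρ g * coordProj b x * ρ g⁻¹ := by
    rw [hρ.mul_coordProj, mul_assoc, ← map_mul, mul_inv_cancel, map_one, mul_one]
  have hright : ρ g * f * ρ g⁻¹ * coordProj b (g • z.2) =
      ρ g * (f * coordProj b z.2) * ρ g⁻¹ := by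
    simp only [hproj, mul_assoc, hcancel]
  rw [reducedEntry_apply, reducedEntry_apply, Prod.smul_snd, hright, trace_conj, Prod.smul_fst,
    hproj, mul_sub, sub_mul, mul_smul_comm, smul_mul_assoc]
  simp only [mul_assoc, hcancel, ← map_mul, inv_mul_cancel, map_one, mul_one]

theorem exists_sum_conj_eq [Fintype G] [Finite Ω] (hρ : IsMonomial ρ b)
    (hpair : ∀ x y : Ω, x ≠ y → (Nat.card (MulAction.stabilizer G (x, y)) : k) ≠ 0) :
    ∃ ψ : Module.End k V →ₗ[k] Module.End k V, ∀ f,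
      ∑ g, ρ g⁻¹ * ψ (ρ g * f * ρ g⁻¹) * ρ g = f - LinearMap.trace k V f • 1 := by
  have := Fintype.ofFinite Ω
  have : FiniteDimensional k V := .of_basis b
  obtain ⟨w, hw⟩ := exists_weight_sum_smul_eq_one k G (Ω := Ω × Ω)
  refine ⟨∑ z, w z • reducedEntry b z, fun f ↦ ?_⟩
  have hsum (g : G) : ρ g⁻¹ * (∑ z, w z • reducedEntry b z) (ρ g * f * ρ g⁻¹) * ρ g =
      ∑ z, w (g • z) • reducedEntry b z f := by
    rw [← Equiv.sum_comp (MulAction.toPerm g)]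
    simp only [MulAction.toPerm_apply, LinearMap.sum_apply, LinearMap.smul_apply, Finset.mul_sum,
      Finset.sum_mul, mul_smul_comm, smul_mul_assoc, hρ.conj_reducedEntry]
  rw [Finset.sum_congr rfl fun g _ ↦ hsum g, Finset.sum_comm, ← sum_reducedEntry b]
  refine Finset.sum_congr rfl fun z _ ↦ ?_
  obtain ⟨x, y⟩ := z
  obtain rfl | hxy := eq_or_ne x y
  · simp only [reducedEntry_diag, LinearMap.zero_apply, smul_zero, Finset.sum_const_zero]
  · rw [← Finset.sum_smul, hw _ (hpair x y hxy), one_smul]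

theorem isEndotrivial [Finite G] [Finite Ω] (hρ : IsMonomial ρ b) (hΩ : (Nat.card Ω : k) ≠ 0)
    (hpair : ∀ x y : Ω, x ≠ y → (Nat.card (MulAction.stabilizer G (x, y)) : k) ≠ 0) :
    IsEndotrivial ρ := by
  have := Fintype.ofFinite G
  have : FiniteDimensional k V := .of_basis b
  obtain ⟨ψ, hψ⟩ := hρ.exists_sum_conj_eq hpair
  refine .of_sum_conj_eq (by rwa [Module.finrank_eq_nat_card_basis b]) ψ fun f hf ↦ ?_
  rw [hψ, hf, zero_smul, sub_zero]

/- A difference `ρ g - 1` of rank one turns a vector of a subrepresentation with nonzero coordinate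
at `ω` into a multiple of `b ω`. -/
theorem isIrreducible [Nonempty Ω] [MulAction.IsPretransitive G Ω] (hρ : IsMonomial ρ b)
    (hrefl : ∀ ω, ∃ g, ∃ c ≠ (0 : k), ρ g - 1 = c • coordProj b ω) : ρ.IsIrreducible := by
  have : Nontrivial V := b.repr.toEquiv.nontrivial
  refine { exists_pair_ne := ⟨⊥, ⊤, fun h ↦ bot_ne_top (α := Submodule k V)
      (congrArg Subrepresentation.toSubmodule h)⟩
           eq_bot_or_eq_top := fun W ↦ or_iff_not_imp_left.mpr fun hW ↦ ?_ }
  obtain ⟨v, hvW, hv⟩ := W.toSubmodule.exists_mem_ne_zero_of_ne_bot fun h ↦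
    hW (Subrepresentation.toSubmodule_injective h)
  obtain ⟨ω, hω⟩ := Finsupp.ne_iff.mp ((map_ne_zero_iff _ b.repr.injective).mpr hv)
  have hmem : b ω ∈ W.toSubmodule := by
    obtain ⟨g, c, hc, hg⟩ := hrefl ω
    have hsub : ρ g v - v = (c * b.repr v ω) • b ω := by
      rw [mul_smul]
      exact LinearMap.congr_fun hg v
    rw [← W.toSubmodule.smul_mem_iff (mul_ne_zero hc hω), ← hsub]
    exact W.toSubmodule.sub_mem (W.apply_mem_toSubmodule g hvW) hvW
  refine Subrepresentation.toSubmodule_injective (top_unique ?_)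
  change ⊤ ≤ W.toSubmodule
  rw [← b.span_eq, Submodule.span_le]
  rintro _ ⟨x, rfl⟩
  obtain ⟨g, rfl⟩ := MulAction.exists_smul_eq G ω x
  obtain ⟨c, hc⟩ := hρ g ω
  rw [SetLike.mem_coe, ← Submodule.smul_mem_iff' W.toSubmodule c, ← hc]
  exact W.apply_mem_toSubmodule g hmem

end IsMonomial

end Monomial

section Induced

variable {k G V : Type*} [Field k] [Group G] [AddCommGroup V] [Module k V]
  {ρ : Representation k G V}

/-- Frobenius reciprocity: the homomorphism from an induced representation determined by a
homomorphism into the restriction. Unlike `Rep.indResHomEquiv`, it lets the two modules live in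
different universes. -/
noncomputable def indLift {H U : Type*} [Group H] [AddCommGroup U] [Module k U] {φ : H →* G}
    {σ : Representation k H U} (f : σ.IntertwiningMap (ρ.comp φ)) :
    (Representation.ind φ σ).IntertwiningMap ρ where
  toLinearMap := Representation.Coinvariants.lift _
    (TensorProduct.lift <| (Finsupp.lift _ _ _ fun g ↦ ρ g⁻¹ ∘ₗ f.toLinearMap) ∘ₗ
      (MonoidAlgebra.coeffLinearEquiv k).toLinearMap) fun h ↦ by
        ext g u
        have hf : f (σ h u) = ρ (φ h) (f u) := LinearMap.congr_fun (f.isIntertwining' h) u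
        simp [hf]
  isIntertwining' g := by ext; simp

theorem indLift_mk {H U : Type*} [Group H] [AddCommGroup U] [Module k U] {φ : H →* G}
    {σ : Representation k H U} (f : σ.IntertwiningMap (ρ.comp φ)) (g : G) (u : U) :
    indLift f (Representation.IndV.mk φ σ g u) = ρ g⁻¹ (f u) := by
  simp [indLift]

theorem indV_mk_map_mul {H U : Type*} [Group H] [AddCommGroup U] [Module k U] (φ : H →* G)
    (σ : Representation k H U) (h : H) (g : G) (u : U) :
    Representation.IndV.mk φ σ (φ h * g) (σ h u) = Representation.IndV.mk φ σ g u := by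
  simpa using Representation.Coinvariants.mk_self_apply
    (Representation.tprod ((Representation.leftRegular k G).comp φ) σ) h
    (MonoidAlgebra.single g 1 ⊗ₜ u)

theorem nonempty_equiv_ind_of_basis {ι : Type*} (b : Module.Basis ι k V) {H : Subgroup G}
    {σ : Representation k H k} {v : V} (hv : ∀ h : H, ρ h v = σ h 1 • v) {r : ι → G}
    (hr : ∀ g, ∃ i, (r i)⁻¹ * g ∈ H) (hb : ∀ i, ρ (r i) v = b i) :
    Nonempty (ρ.Equiv (Representation.ind H.subtype σ)) := by
  let f : σ.IntertwiningMap (ρ.comp H.subtype) :=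
    { toLinearMap := LinearMap.toSpanSingleton k V v
      isIntertwining' := fun h ↦ LinearMap.ext_ring <| by simp [hv] }
  have hf (g : G) (c : k) : indLift f (Representation.IndV.mk H.subtype σ g c) = c • ρ g⁻¹ v :=
    (indLift_mk f g c).trans (map_smul (ρ g⁻¹) c v)
  let s : V →ₗ[k] Representation.IndV H.subtype σ :=
    b.constr k fun i ↦ Representation.IndV.mk H.subtype σ (r i)⁻¹ 1
  have hs (i : ι) : s (b i) = Representation.IndV.mk H.subtype σ (r i)⁻¹ 1 :=
    b.constr_basis k _ i
  have left_inv : s ∘ₗ (indLift f).toLinearMap = LinearMap.id := by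
    refine Representation.IndV.hom_ext _ _ fun g ↦ LinearMap.ext_ring ?_
    obtain ⟨i, hi⟩ := hr g⁻¹
    let h : H := ⟨(r i)⁻¹ * g⁻¹, hi⟩
    have hg : ρ g⁻¹ v = σ h 1 • b i := by
      rw [← hb, ← map_smul, ← hv, ← Module.End.mul_apply, ← map_mul, mul_inv_cancel_left]
    calc
      s (indLift f (Representation.IndV.mk H.subtype σ g 1))
      _ = Representation.IndV.mk H.subtype σ (r i)⁻¹ (σ h 1) := by
        rw [hf, one_smul, hg, map_smul, hs, ← map_smul, smul_eq_mul, mul_one]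
      _ = Representation.IndV.mk H.subtype σ (h * g) (σ h 1) := by rw [inv_mul_cancel_right]
      _ = Representation.IndV.mk H.subtype σ g 1 := indV_mk_map_mul H.subtype σ h g 1
  have right_inv : (indLift f).toLinearMap ∘ₗ s = LinearMap.id := by
    refine b.ext fun i ↦ ?_
    rw [LinearMap.comp_apply, hs, LinearMap.id_apply]
    exact (hf _ 1).trans (by rw [inv_inv, one_smul, hb])
  exact ⟨((indLift f).ofBijective (Function.bijective_iff_has_inverse.mpr
    ⟨s, LinearMap.congr_fun left_inv, LinearMap.congr_fun right_inv⟩)).symm⟩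

namespace IsMonomial

variable {Ω : Type*} [MulAction G Ω] {b : Module.Basis Ω k V}

theorem apply_eq_repr_smul (hρ : IsMonomial ρ b) (g : G) (x : Ω) :
    ρ g (b x) = b.repr (ρ g (b x)) (g • x) • b (g • x) := by
  obtain ⟨c, hc⟩ := hρ g x
  rw [hc, Units.smul_def, map_smul b.repr, b.repr_self, Finsupp.smul_single, Finsupp.single_eq_same,
    smul_eq_mul, mul_one]

/-- The linear character by which the stabilizer of `ω` acts on the line spanned by `b ω`. -/
noncomputable def stabilizerRep (hρ : IsMonomial ρ b) (ω : Ω) :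
    Representation k (MulAction.stabilizer G ω) k where
  toFun h := b.repr (ρ h (b ω)) ω • 1
  map_one' := by simp
  map_mul' g h := by
    have hh : ρ h (b ω) = b.repr (ρ h (b ω)) ω • b ω := by
      simpa only [show (h : G) • ω = ω from h.2] using hρ.apply_eq_repr_smul h ω
    rw [Subgroup.coe_mul, map_mul, Module.End.mul_apply, hh, map_smul, map_smul, map_smul,
      b.repr_self]
    simp [mul_comm, smul_smul]

theorem apply_eq_stabilizerRep_smul (hρ : IsMonomial ρ b) (ω : Ω) (h : MulAction.stabilizer G ω) :
    ρ h (b ω) = hρ.stabilizerRep ω h 1 • b ω := by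
  have hh := hρ.apply_eq_repr_smul h ω
  rw [show (h : G) • ω = ω from h.2] at hh
  simpa [stabilizerRep] using hh

theorem nonempty_equiv_ind [MulAction.IsPretransitive G Ω] (hρ : IsMonomial ρ b) (ω : Ω) :
    Nonempty (ρ.Equiv (Representation.ind (MulAction.stabilizer G ω).subtype
      (hρ.stabilizerRep ω))) := by
  choose r hr using MulAction.exists_smul_eq G ω
  choose c hc using fun x ↦ hρ (r x) ω
  refine nonempty_equiv_ind_of_basis (b.unitsSMul c) (hρ.apply_eq_stabilizerRep_smul ω) (r := r)
    (fun g ↦ ⟨g • ω, ?_⟩) fun x ↦ ?_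
  · rw [MulAction.mem_stabilizer_iff, mul_smul, inv_smul_eq_iff, hr]
  · rw [hc, hr, Module.Basis.unitsSMul_apply]

end IsMonomial

end Induced

section PermWreath

variable {C G Ω : Type*} [CommGroup C] [Group G] [MulAction G Ω]

/-- The permutational wreath product `C ≀ G` along the action of `G` on `Ω`. -/
abbrev PermWreath (C G Ω : Type*) [CommGroup C] [Group G] [MulAction G Ω] : Type _ :=
  (Ω → C) ⋊[mulAutArrow] G

namespace PermWreath

instance : MulAction (PermWreath C G Ω) Ω := MulAction.compHom Ω SemidirectProduct.rightHom

theorem smul_eq_right_smul (g : PermWreath C G Ω) (ω : Ω) : g • ω = g.right • ω := rfl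

instance [Finite C] [Finite G] [Finite Ω] : Finite (PermWreath C G Ω) :=
  .of_equiv _ SemidirectProduct.equivProd.symm

instance [MulAction.IsPretransitive G Ω] : MulAction.IsPretransitive (PermWreath C G Ω) Ω where
  exists_smul_eq x y := by
    obtain ⟨g, hg⟩ := MulAction.exists_smul_eq G x y
    exact ⟨SemidirectProduct.inr g, hg⟩

instance : IsMulCommutative (SemidirectProduct.rightHom : PermWreath C G Ω →* G).ker := by
  rw [← SemidirectProduct.range_inl_eq_ker_rightHom]
  infer_instance

theorem not_dvd_card_ker_rightHom {p : ℕ} [Fact p.Prime] [Finite Ω] (hC : ¬ p ∣ Nat.card C) :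
    ¬ p ∣ Nat.card (SemidirectProduct.rightHom : PermWreath C G Ω →* G).ker := by
  rw [← SemidirectProduct.range_inl_eq_ker_rightHom,
    ← Nat.card_congr (MonoidHom.ofInjective SemidirectProduct.inl_injective).toEquiv, Nat.card_fun]
  exact mt (Fact.out : p.Prime).dvd_of_dvd_pow hC

theorem centralizer_ker_rightHom_le [Nontrivial C] [FaithfulSMul G Ω] :
    Subgroup.centralizer ((SemidirectProduct.rightHom : PermWreath C G Ω →* G).ker : Set _) ≤
      (SemidirectProduct.rightHom : PermWreath C G Ω →* G).ker := by
  classical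
  intro g hg
  obtain ⟨c, hc⟩ := exists_ne (1 : C)
  refine FaithfulSMul.eq_of_smul_eq_smul (α := Ω) fun ω ↦ ?_
  by_contra hne
  have hω : g.right • ω ≠ ω := fun h ↦ hne (h.trans (one_smul G ω).symm)
  have hcomm := Subgroup.mem_centralizer_iff.mp hg
    (SemidirectProduct.inl (Pi.mulSingle ω c)) (by simp)
  have hval : (Pi.mulSingle ω c : Ω → C) (g.right • ω) * g.left ((1 : G)⁻¹ • g.right • ω) =
      g.left (g.right • ω) * (Pi.mulSingle ω c : Ω → C) (g.right⁻¹ • g.right • ω) :=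
    congrFun (congrArg SemidirectProduct.left hcomm) (g.right • ω)
  rw [inv_one, one_smul, inv_smul_smul, Pi.mulSingle_eq_same, Pi.mulSingle_eq_of_ne hω, one_mul,
    left_eq_mul] at hval
  exact hc hval

end PermWreath

variable {k : Type*} [Field k]

/-- The representation of `C ≀ G` on functions `Ω → k` in which `G` permutes the coordinates and
the copy of `C` at `ω` acts on the coordinate at `ω` through the linear character `χ`. -/
def monomialRep (χ : C →* kˣ) : Representation k (PermWreath C G Ω) (Ω → k) where
  toFun g :=
    { toFun := fun f ω ↦ χ (g.left ω) * f (g.right⁻¹ • ω)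
      map_add' := fun _ _ ↦ by ext; simp [mul_add]
      map_smul' := fun _ _ ↦ by ext; simp [mul_left_comm] }
  map_one' := by ext; simp
  map_mul' g h := by
    refine LinearMap.ext fun f ↦ funext fun ω ↦ ?_
    have hleft : (g * h).left ω = g.left ω * h.left (g.right⁻¹ • ω) := rfl
    change (χ ((g * h).left ω) : k) * f ((g * h).right⁻¹ • ω) =
      χ (g.left ω) * (χ (h.left (g.right⁻¹ • ω)) * f (h.right⁻¹ • g.right⁻¹ • ω))
    rw [hleft, SemidirectProduct.mul_right, mul_inv_rev, mul_smul, map_mul, Units.val_mul,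
      mul_assoc]

theorem monomialRep_apply (χ : C →* kˣ) (g : PermWreath C G Ω) (f : Ω → k) (ω : Ω) :
    monomialRep χ g f ω = χ (g.left ω) * f (g.right⁻¹ • ω) := rfl

variable [Finite Ω]

theorem isMonomial_monomialRep (χ : C →* kˣ) :
    IsMonomial (monomialRep χ : Representation k (PermWreath C G Ω) (Ω → k))
      (Pi.basisFun k Ω) := by
  classical
  intro g ω
  refine ⟨χ (g.left (g • ω)), ?_⟩
  ext x
  rw [monomialRep_apply, Pi.basisFun_apply, Pi.basisFun_apply, Pi.smul_apply, Units.smul_def,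
    smul_eq_mul, PermWreath.smul_eq_right_smul]
  obtain rfl | hx := eq_or_ne x (g.right • ω)
  · rw [inv_smul_smul, Pi.single_eq_same, Pi.single_eq_same]
  · rw [Pi.single_eq_of_ne hx, Pi.single_eq_of_ne (mt inv_smul_eq_iff.mp hx), mul_zero, mul_zero]

theorem monomialRep_inl_mulSingle_sub_one [DecidableEq Ω] (χ : C →* kˣ) (c : C) (ω : Ω) :
    monomialRep χ (SemidirectProduct.inl (Pi.mulSingle ω c) : PermWreath C G Ω) - 1 =
      ((χ c : k) - 1) • coordProj (Pi.basisFun k Ω) ω := by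
  refine LinearMap.ext fun f ↦ funext fun x ↦ ?_
  rw [LinearMap.sub_apply, Pi.sub_apply, monomialRep_apply, LinearMap.smul_apply, coordProj_apply]
  obtain rfl | hx := eq_or_ne x ω
  · simp [sub_mul]
  · simp [hx]

theorem isIrreducible_monomialRep [Nonempty Ω] [MulAction.IsPretransitive G Ω] {χ : C →* kˣ}
    (hχ : χ ≠ 1) :
    (monomialRep χ : Representation k (PermWreath C G Ω) (Ω → k)).IsIrreducible := by
  classical
  obtain ⟨c, hc⟩ := DFunLike.ne_iff.mp hχ
  exact (isMonomial_monomialRep χ).isIrreducible fun ω ↦ ⟨_, _,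
    sub_ne_zero.mpr fun h ↦ hc (Units.ext h), monomialRep_inl_mulSingle_sub_one χ c ω⟩

theorem AtMostOneFixedPoint.isEndotrivial_monomialRep {p : ℕ} [Fact p.Prime] [CharP k p]
    [Finite C] [Finite G] (hG : AtMostOneFixedPoint p G Ω) (hΩ : Nat.card Ω ≡ 1 [MOD p])
    (hC : ¬ p ∣ Nat.card C) (χ : C →* kˣ) :
    IsEndotrivial (monomialRep χ : Representation k (PermWreath C G Ω) (Ω → k)) := by
  have hwr : AtMostOneFixedPoint p (PermWreath C G Ω) Ω :=
    hG.compHom _ (PermWreath.not_dvd_card_ker_rightHom hC)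
  refine (isMonomial_monomialRep χ).isEndotrivial ?_ fun x y hxy ↦ ?_
  · rw [CharP.natCast_eq_natCast' k p hΩ, Nat.cast_one]
    exact one_ne_zero
  · exact (CharP.cast_eq_zero_iff k p _).not.mpr (hwr.not_dvd_card_stabilizer hxy)

end PermWreath

theorem stabilizer_ne_top {G Ω : Type*} [Group G] [MulAction G Ω] [MulAction.IsPretransitive G Ω]
    [Nontrivial Ω] (ω : Ω) : MulAction.stabilizer G ω ≠ ⊤ := fun h ↦ by
  obtain ⟨x, hx⟩ := exists_ne ω
  obtain ⟨g, hg⟩ := MulAction.exists_smul_eq G ω x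
  have hmem : g ∈ MulAction.stabilizer G ω := h ▸ Subgroup.mem_top g
  exact hx (hg.symm.trans hmem)

theorem exists_isOfFinOrder_ne_one (k : Type*) [Field k] [IsAlgClosed k] (p : ℕ) [Fact p.Prime]
    [CharP k p] : ∃ ζ : kˣ, IsOfFinOrder ζ ∧ ζ ≠ 1 := by
  obtain ⟨q, hpq, hq⟩ := Nat.exists_infinite_primes (p + 1)
  have : NeZero (q : k) := ⟨(CharP.cast_eq_zero_iff k p q).not.mpr fun h ↦
    (Nat.lt_of_succ_le hpq).ne ((Nat.prime_dvd_prime_iff_eq Fact.out hq).mp h)⟩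
  obtain ⟨ζ, hζ⟩ := HasEnoughRootsOfUnity.exists_primitiveRoot k q
  obtain ⟨u, rfl⟩ := hζ.isUnit hq.ne_zero
  have hu : IsPrimitiveRoot u q := IsPrimitiveRoot.coe_units_iff.mp hζ
  exact ⟨u, hu.isOfFinOrder hq.ne_zero, hu.ne_one hq.one_lt⟩

/- `C` is a copy of the group generated by `ζ`, which itself lives in the universe of `k` and not
in that of `X`. -/
theorem exists_monoidHom_ne_one {k : Type*} [Field k] (p : ℕ) [Fact p.Prime] [CharP k p] {ζ : kˣ}
    (hζ : IsOfFinOrder ζ) (hζ1 : ζ ≠ 1) :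
    ∃ (C : Type) (_ : CommGroup C) (_ : Finite C) (χ : C →* kˣ), ¬ p ∣ Nat.card C ∧ χ ≠ 1 := by
  let e := zmodCyclicMulEquiv (inferInstance : IsCyclic (Subgroup.zpowers ζ))
  have : NeZero (Nat.card (Subgroup.zpowers ζ)) := ⟨by
    rw [Nat.card_zpowers]
    exact hζ.orderOf_pos.ne'⟩
  refine ⟨Multiplicative (ZMod (Nat.card (Subgroup.zpowers ζ))), inferInstance, inferInstance,
    (Subgroup.zpowers ζ).subtype.comp e.toMonoidHom, ?_, fun h ↦ hζ1 ?_⟩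
  · have hprim : IsPrimitiveRoot (ζ : k) (orderOf ζ) :=
      IsPrimitiveRoot.coe_units_iff.mpr (.orderOf ζ)
    have : NeZero (orderOf ζ) := ⟨hζ.orderOf_pos.ne'⟩
    rw [Nat.card_congr e.toEquiv, Nat.card_zpowers, ← CharP.cast_eq_zero_iff k p]
    exact hprim.neZero'.out
  · have hval := DFunLike.congr_fun h (e.symm ⟨ζ, Subgroup.mem_zpowers ζ⟩)
    simpa using hval

theorem lemma5_general {k : Type u} [Field k] (p : ℕ) [Fact p.Prime] [CharP k p] {ζ : kˣ}
    (hζ : IsOfFinOrder ζ) (hζ1 : ζ ≠ 1) {X : Type v} [Group X] [Finite X]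
    (hX : pPrimeCore p X = ⊥) (Y : Subgroup X) (hY : IsStronglyEmbedded p Y) :
    ∃ (G : Type v) (_ : Group G) (_ : Finite G) (A : Subgroup G) (_ : A.Normal),
      generalizedFittingSubgroup G = A ∧ IsMulCommutative A ∧ ¬ p ∣ Nat.card A ∧
      Nonempty (G ⧸ A ≃* X) ∧
      ∃ (V : Type (max u v)) (_ : AddCommGroup V) (_ : Module k V) (ρ : Representation k G V),
        ρ.IsIrreducible ∧ IsEndotrivial ρ ∧
        ∃ (H : Subgroup G) (U : Type u) (_ : AddCommGroup U) (_ : Module k U)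
          (σ : Representation k H U),
          H ≠ ⊤ ∧ Module.finrank k U = 1 ∧
          Nonempty (ρ.Equiv (Representation.ind H.subtype σ)) := by
  obtain ⟨C, _, _, χ, hC, hχ⟩ := exists_monoidHom_ne_one p hζ hζ1
  have : Nontrivial C := not_subsingleton_iff_nontrivial.mp fun _ ↦ hχ (Subsingleton.elim _ _)
  have : Nontrivial (X ⧸ Y) := QuotientGroup.nontrivial_iff.mpr hY.1
  have hfix := hY.atMostOneFixedPoint
  have : FaithfulSMul X (X ⧸ Y) := hfix.faithfulSMul hX
  let π : PermWreath C X (X ⧸ Y) →* X := SemidirectProduct.rightHom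
  have hπ : Function.Surjective π := SemidirectProduct.rightHom_surjective
  have hker : ¬ p ∣ Nat.card π.ker := PermWreath.not_dvd_card_ker_rightHom hC
  let ω : X ⧸ Y := (1 : X)
  exact ⟨PermWreath C X (X ⧸ Y), inferInstance, inferInstance, π.ker, inferInstance,
    generalizedFittingSubgroup_eq_ker hX hπ hker PermWreath.centralizer_ker_rightHom_le,
    inferInstance, hker, ⟨QuotientGroup.quotientKerEquivOfSurjective π hπ⟩,
    X ⧸ Y → k, inferInstance, inferInstance, monomialRep χ, isIrreducible_monomialRep hχ,
    hfix.isEndotrivial_monomialRep hY.card_quotient_modEq_one hC χ,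
    MulAction.stabilizer _ ω, k, inferInstance, inferInstance, _, stabilizer_ne_top ω,
    Module.finrank_self k, (isMonomial_monomialRep χ).nonempty_equiv_ind ω⟩

theorem lemma5 {k : Type u} [Field k] [IsAlgClosed k] (p : ℕ) [Fact p.Prime] [CharP k p]
    {X : Type v} [Group X] [Finite X] (hpX : p ∣ Nat.card X) (hX : pPrimeCore p X = ⊥)
    (Y : Subgroup X) (hY : IsStronglyEmbedded p Y) :
    ∃ (G : Type v) (_ : Group G) (_ : Finite G) (A : Subgroup G) (_ : A.Normal),
      generalizedFittingSubgroup G = A ∧ IsMulCommutative A ∧ ¬ p ∣ Nat.card A ∧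
      Nonempty (G ⧸ A ≃* X) ∧
      ∃ (V : Type (max u v)) (_ : AddCommGroup V) (_ : Module k V) (ρ : Representation k G V),
        ρ.IsIrreducible ∧ IsEndotrivial ρ ∧
        ∃ (H : Subgroup G) (U : Type u) (_ : AddCommGroup U) (_ : Module k U)
          (σ : Representation k H U),
          H ≠ ⊤ ∧ Module.finrank k U = 1 ∧
          Nonempty (ρ.Equiv (Representation.ind H.subtype σ)) := by
  obtain ⟨ζ, hζ, hζ1⟩ := exists_isOfFinOrder_ne_one k p
  exact lemma5_general p hζ hζ1 hX Y hY
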